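/- **Setting.** An array $A$ of length $n$ has $n$ distinct entries $A[1],\dots,A[n]$ from an (infinite) linearly ordered set, and $e\in A$ is a target element. Write $\mathrm{pos}(e)$ for the index with $A[\mathrm{pos}(e)]=e$ and $\mathrm{rank}(e)=|\{i: A[i]<e\}|+1$. A *query* of an index $i$ reveals whether $A[i]<e$, $A[i]=e$ or $A[i]>e$. A *search algorithm* is a deterministic adaptive procedure (a decision tree, which may depend on $n$ and $k$) that makes queries and finally outputs an index or "not present". A *block swap* exchanges two disjoint (possibly adjacent, possibly empty, possibly differently sized) blocks of consecutive entries of the array, i.e. it turns $XBYCZ$ into $XCYBZ$. Let $k_{\mathrm{bswap}}(A)$ be the minimum number of block swaps needed to sort $A$. **Theorem.** There is a function $r(n,k)$ with $r(n,k)=o(\sqrt{nk})$ as $k\to\infty$ and $n/k\to\infty$ such that the following holds for all integers $n\ge 1$ and $k\ge 0$. Let $S$ be any search algorithm for arrays of length $n$ that outputs $\mathrm{pos}(e)$ on every input $(A,e)$ with $k_{\mathrm{bswap}}(A)\le k$, $e\in A$ and $\mathrm{pos}(e)=\mathrm{rank}(e)$. Then there is such an input $(A,e)$ on which $S$ makes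 at least $$4\sqrt{nk}-r(n,k)$$ queries. -/

import Mathlib

namespace BlockSearch

/-! ### Block swaps and the number of block swaps needed to sort -/

section Arrays

variable {α : Type*}

/-- `L'` arises from `L` by exchanging two disjoint blocks `B` and `C` of consecutive entries.
The two blocks may have different sizes, may be adjacent, and a block may be empty. -/
def BlockSwap (L L' : List α) : Prop :=
  ∃ X B Y C Z : List α, L = X ++ B ++ Y ++ C ++ Z ∧ L' = X ++ C ++ Y ++ B ++ Z

/-- Some sequence of exactly `m` block swaps turns `L` into a sorted list. -/
def SortableIn [LinearOrder α] : ℕ → List α → Prop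
  | 0, L => L.Pairwise (· ≤ ·)
  | m + 1, L => ∃ L', BlockSwap L L' ∧ SortableIn m L'

/-- The minimum number of block swaps needed to sort the array `A`. -/
noncomputable def kbswap [LinearOrder α] {n : ℕ} (A : Fin n → α) : ℕ :=
  sInf {m | SortableIn m (List.ofFn A)}

/-- The correct (one-based) position of `e` with respect to a sorted copy of `A`. -/
def rank [LinearOrder α] {n : ℕ} (A : Fin n → α) (e : α) : ℕ :=
  (Finset.univ.filter fun j => A j < e).card + 1

/-- `A` is an array with distinct entries that needs at most `k` block swaps to be sorted, and the
target `e = A i` is located at its correct position: `pos(e) = i + 1 = rank(e)` (positions of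
arrays are counted from one, `Fin n` is counted from zero). -/
structure IsInstance [LinearOrder α] {n : ℕ} (k : ℕ) (A : Fin n → α) (i : Fin n) : Prop where
  injective : Function.Injective A
  kbswap_le : kbswap A ≤ k
  pos_eq_rank : (i : ℕ) + 1 = rank A (A i)

/-! The minimum in `kbswap` is always over a non-empty set. -/

theorem reflTransGen_blockSwap_of_perm {L L' : List α} (h : L.Perm L') :
    Relation.ReflTransGen BlockSwap L L' := by
  induction h with
  | nil => exact .refl
  | cons a _ ih =>
    refine ih.lift (a :: ·) ?_
    rintro _ _ ⟨X, B, Y, C, Z, rfl, rfl⟩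
    exact ⟨a :: X, B, Y, C, Z, by simp, by simp⟩
  | swap a b l => exact .single ⟨[], [b], [], [a], l, by simp, by simp⟩
  | trans _ _ ih₁ ih₂ => exact ih₁.trans ih₂

variable [LinearOrder α]

theorem exists_sortableIn (L : List α) : ∃ m, SortableIn m L := by
  have key : ∀ L₁ L₂ : List α, Relation.ReflTransGen BlockSwap L₁ L₂ → SortableIn 0 L₂ →
      ∃ m, SortableIn m L₁ := by
    intro L₁ L₂ h hs
    induction h using Relation.ReflTransGen.head_induction_on with
    | refl => exact ⟨0, hs⟩
    | head h _ ih =>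
      obtain ⟨m, hm⟩ := ih
      exact ⟨m + 1, _, h, hm⟩
  exact key L _ (reflTransGen_blockSwap_of_perm (List.mergeSort_perm L _).symm)
    (List.pairwise_mergeSort' (· ≤ ·) L)

theorem sortableIn_kbswap {n : ℕ} (A : Fin n → α) : SortableIn (kbswap A) (List.ofFn A) :=
  Nat.sInf_mem (exists_sortableIn (List.ofFn A))

end Arrays

/-! ### Search algorithms -/

/-- A deterministic adaptive search algorithm for arrays of length `n`: a decision tree that either
stops with an answer (`some i`: the target is at index `i`; `none`: the target is absent), or
queries an index and continues depending on the outcome of the query. -/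
inductive SearchAlg (n : ℕ) : Type
  | answer (ans : Option (Fin n)) : SearchAlg n
  | query (i : Fin n) (next : Ordering → SearchAlg n) : SearchAlg n

namespace SearchAlg

variable {n : ℕ} {α : Type*} [LinearOrder α]

/-- The answer of the algorithm on array `A` and target `e`. Querying `i` yields `lt`, `eq`, `gt`
according to whether `A i < e`, `A i = e`, `A i > e`. -/
def run (A : Fin n → α) (e : α) : SearchAlg n → Option (Fin n)
  | answer ans => ans
  | query i next => run A e (next (compare (A i) e))

/-- The number of queries that the algorithm makes on array `A` and target `e`. -/
def numQueries (A : Fin n → α) (e : α) : SearchAlg n → ℕ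
  | answer _ => 0
  | query i next => numQueries A e (next (compare (A i) e)) + 1

/-- The algorithm finds the target on every array of length `n` with entries in `α` that needs at
most `k` block swaps to be sorted and contains the target at its correct position. -/
def FindsTarget (α : Type*) [LinearOrder α] (k : ℕ) (S : SearchAlg n) : Prop :=
  ∀ (A : Fin n → α) (i : Fin n), IsInstance k A i → S.run A (A i) = some i

end SearchAlg

/-- The asymptotic regime `k → ∞`, `n / k → ∞` for pairs `(n, k)`. -/
noncomputable def regime : Filter (ℕ × ℕ) :=
  Filter.comap (fun p => p.2) Filter.atTop ⊓
    Filter.comap (fun p => (p.1 : ℝ) / (p.2 : ℝ)) Filter.atTop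

end BlockSearch

/-!
The lower bound comes from an oblivious adversary. With `m = n / 2`, it answers every query of an
index below `m` by "smaller than the target" and every other query by "larger". An algorithm that
asks too few queries leaves two possible indices of the target, each realised by an instance that
gives exactly these answers (`exists_two_isConsistent`), so it cannot output the correct one on both.

*Realising a pattern.* A pattern of smaller and larger entries with `d` descents is sorted by
`⌈d / 2⌉` block swaps, because exchanging two blocks removes two descents at once
(`sortableIn_of_card_descents_le`). Running such a sorting backwards from a sorted array labels the
pattern by distinct values; one further swap takes care of the target
(`exists_isInstance_of_pattern`). This gain of two descents per swap is what produces the constant.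

*Where the target can hide.* Place the target at distance `p` from the centre, on either side. It is
at its correct position as soon as exactly `p` other entries on the same side of the centre, all of
them unqueried, compare to the target in the way opposite to the adversary's answer for that side.
The number of runs formed by these entries bounds the number
of descents, so up to about `2 * k` runs are available. Let `W` be the largest number of entries
that `K = 2 * k - 4` runs of unqueried entries of one side can contain. Then every unqueried index
at distance less than `W` from the centre is a possible index of the target, hence almost all of
these `W` indices must be queried. If `q` further queries are made on this side, of length `M`, they
leave at most `q + 1` gaps beyond distance `W`, and comparing the `K` longest gaps with the average
gives `(q + 1 + K) * W ≥ K * (M - W - q)` (`exists_threshold`). Hence `W * (q + 1)` is at least about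
`K * M ≈ n * k`, and the number `W + q` of queries on this side is at least about `2 * √(n * k)`
(`two_mul_sqrt_le_of_threshold`). The two sides add up to `4 * √(n * k)`.
-/

namespace BlockSearch

/-! ### Sorting words with few descents -/

section Words

/-- The word `0^a₁ 1^b₁ 0^a₂ 1^b₂ ⋯` with the given list of exponents `(a₁, b₁), (a₂, b₂), …`. -/
def blockWord (p : List (ℕ × ℕ)) : List Bool :=
  p.flatMap fun x => List.replicate x.1 false ++ List.replicate x.2 true

/-- One block swap merges the first three exponent pairs into one:
`0^a 1^b 0^c 1^d 0^e 1^f` becomes `0^(a+e+c) 1^(d+b+f)` when `1^b` and `0^e` trade places. -/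
theorem sortableIn_blockWord (m : ℕ) (p : List (ℕ × ℕ)) (hp : p.length ≤ 2 * m + 1) :
    SortableIn m (blockWord p) := by
  have sorted_pair : ∀ a b : ℕ,
      (List.replicate a false ++ List.replicate b true).Pairwise (· ≤ ·) := by
    intro a b
    rw [List.pairwise_append]
    refine ⟨?_, ?_, ?_⟩
    · simp [List.pairwise_replicate]
    · simp [List.pairwise_replicate]
    · intro x hx y hy
      rw [List.eq_of_mem_replicate hx]
      exact Bool.false_le y
  induction m generalizing p with
  | zero =>
    match p, hp with
    | [], _ => simp [SortableIn, blockWord]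
    | [x], _ => simpa [SortableIn, blockWord] using sorted_pair x.1 x.2
    | _ :: _ :: _, h => simp at h
  | succ m ih =>
    match p, hp with
    | [], _ => exact ⟨_, ⟨[], [], [], [], [], by simp [blockWord], rfl⟩, ih [] (by simp)⟩
    | [x], _ => exact ⟨_, ⟨blockWord [x], [], [], [], [], by simp, rfl⟩,
        by simpa using ih [x] (by simp)⟩
    | [x, y], _ =>
      refine ⟨blockWord [(x.1 + y.1, x.2 + y.2)], ⟨List.replicate x.1 false,
        List.replicate x.2 true, [], List.replicate y.1 false, List.replicate y.2 true,
        by simp [blockWord],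
        by simp [blockWord, List.replicate_add, -List.replicate_append_replicate]⟩, ih _ (by simp)⟩
    | x :: y :: z :: rest, h =>
      refine ⟨blockWord ((x.1 + z.1 + y.1, y.2 + x.2 + z.2) :: rest), ⟨List.replicate x.1 false,
        List.replicate x.2 true, List.replicate y.1 false ++ List.replicate y.2 true,
        List.replicate z.1 false, List.replicate z.2 true ++ blockWord rest,
        by simp [blockWord],
        by simp [blockWord, List.replicate_add, -List.replicate_append_replicate]⟩, ih _ ?_⟩
      simp only [List.length_cons] at h ⊢
      omega

/-- Every word is a block word in which each pair of exponents but the last accounts for a descent.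
The last clause lets the induction append a `0` to the last pair when the word ends in `0`. -/
theorem exists_blockWord (f : ℕ → Bool) (n : ℕ) :
    ∃ (p : List (ℕ × ℕ)) (a b : ℕ), (List.range (n + 1)).map f = blockWord (p ++ [(a, b)]) ∧
      p.length ≤ ((Finset.range n).filter fun x => f x = true ∧ f (x + 1) = false).card ∧
      (f n = false → b = 0) := by
  induction n with
  | zero =>
    cases h : f 0
    · exact ⟨[], 1, 0, by simp [blockWord, h], by simp, by simp⟩
    · exact ⟨[], 0, 1, by simp [blockWord, h], by simp, by simp⟩
  | succ n ih =>
    obtain ⟨p, a, b, hw, hlen, hb⟩ := ih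
    rw [List.range_succ, List.map_append, hw]
    have hmono : ((Finset.range n).filter fun x => f x = true ∧ f (x + 1) = false).card ≤
        ((Finset.range (n + 1)).filter fun x => f x = true ∧ f (x + 1) = false).card :=
      Finset.card_le_card (Finset.filter_subset_filter _ (by simp))
    cases h : f (n + 1)
    · cases h' : f n
      · refine ⟨p, a + 1, 0, ?_, hlen.trans hmono, by simp⟩
        simp [blockWord, hb h', List.replicate_add, h]
      · refine ⟨p ++ [(a, b)], 1, 0, by simp [blockWord, h], ?_, by simp⟩
        rw [Finset.range_add_one, Finset.filter_insert, if_pos ⟨h', h⟩,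
          Finset.card_insert_of_notMem (by simp)]
        simpa using hlen
    · refine ⟨p, a, b + 1, ?_, hlen.trans hmono, by simp⟩
      simp [blockWord, List.replicate_add, h]

/-- A boolean word with at most `2 * m` descents is sorted by `m` block swaps: one swap can remove
two descents. -/
theorem sortableIn_of_card_descents_le (f : ℕ → Bool) (n m : ℕ)
    (h : ((Finset.range n).filter fun x => f x = true ∧ f (x + 1) = false).card ≤ 2 * m) :
    SortableIn m ((List.range (n + 1)).map f) := by
  obtain ⟨p, a, b, hw, hlen, -⟩ := exists_blockWord f n
  rw [hw]
  exact sortableIn_blockWord m _ (by simp only [List.length_append, List.length_singleton]; omega)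

end Words

/-! ### Lifting block swaps along a map -/

section Lift

variable {κ β : Type*}

theorem BlockSwap.exists_of_map {g : κ → β} {P : List κ} {u : List β}
    (h : BlockSwap (P.map g) u) : ∃ P', BlockSwap P P' ∧ P'.map g = u ∧ P'.Perm P := by
  obtain ⟨X, B, Y, C, Z, h, rfl⟩ := h
  obtain ⟨P₁, zs, rfl, h₁, rfl⟩ := List.map_eq_append_iff.1 h
  obtain ⟨P₂, cs, rfl, h₂, rfl⟩ := List.map_eq_append_iff.1 h₁
  obtain ⟨P₃, ys, rfl, h₃, rfl⟩ := List.map_eq_append_iff.1 h₂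
  obtain ⟨xs, bs, rfl, rfl, rfl⟩ := List.map_eq_append_iff.1 h₃
  refine ⟨xs ++ cs ++ ys ++ bs ++ zs, ⟨xs, bs, ys, cs, zs, rfl, rfl⟩, by simp, ?_⟩
  classical
  rw [List.perm_iff_count]
  intro a
  simp only [List.count_append]
  omega

theorem BlockSwap.symm {L L' : List κ} (h : BlockSwap L L') : BlockSwap L' L := by
  obtain ⟨X, B, Y, C, Z, rfl, rfl⟩ := h
  exact ⟨X, C, Y, B, Z, rfl, rfl⟩

theorem BlockSwap.map (g : κ → β) {L L' : List κ} (h : BlockSwap L L') :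
    BlockSwap (L.map g) (L'.map g) := by
  obtain ⟨X, B, Y, C, Z, rfl, rfl⟩ := h
  exact ⟨X.map g, B.map g, Y.map g, C.map g, Z.map g, by simp, by simp⟩

/-- Sort the image of a list first and then finish the list itself. -/
theorem SortableIn.add_of_map [LinearOrder κ] [LinearOrder β] (g : κ → β) (c m : ℕ) (P : List κ)
    (h : SortableIn m (P.map g))
    (hfin : ∀ P' : List κ, P'.Perm P → (P'.map g).Pairwise (· ≤ ·) → SortableIn c P') :
    SortableIn (c + m) P := by
  induction m generalizing P with
  | zero => exact hfin P (List.Perm.refl _) h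
  | succ m ih =>
    obtain ⟨u, hu, hs⟩ := h
    obtain ⟨P', hsw, rfl, hp⟩ := hu.exists_of_map
    exact ⟨P', hsw, ih P' hs fun P'' h'' => hfin P'' (h''.trans hp)⟩

/-- A sorting of a word of keys, run backwards from a strictly increasing list `v`, labels the word
by the entries of `v` compatibly with the order of the keys. -/
theorem SortableIn.exists_labelling [LinearOrder κ] [LinearOrder β] (v : List β)
    (hv : v.Pairwise (· < ·)) (m : ℕ) (w : List κ) (hlen : w.length = v.length)
    (h : SortableIn m w) :
    ∃ P : List (κ × β), P.map Prod.fst = w ∧ SortableIn m (P.map Prod.snd) ∧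
      (P.map Prod.snd).Perm v ∧ ∀ p ∈ P, ∀ q ∈ P, p.1 < q.1 → p.2 < q.2 := by
  induction m generalizing w with
  | zero =>
    refine ⟨w.zip v, List.map_fst_zip hlen.le, ?_, ?_, ?_⟩
    · rw [List.map_snd_zip hlen.ge]
      exact hv.imp le_of_lt
    · rw [List.map_snd_zip hlen.ge]
    · intro p hp q hq hpq
      obtain ⟨a, ha, rfl⟩ := List.mem_iff_getElem.1 hp
      obtain ⟨b, hb, rfl⟩ := List.mem_iff_getElem.1 hq
      simp only [List.getElem_zip, List.length_zip, lt_min_iff] at ha hb hpq ⊢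
      have hab : a < b := by
        by_contra hba
        rcases (not_lt.1 hba).eq_or_lt with rfl | hba
        · exact lt_irrefl _ hpq
        · exact (List.pairwise_iff_getElem.1 h b a hb.1 ha.1 hba).not_gt hpq
      exact List.pairwise_iff_getElem.1 hv a b ha.2 hb.2 hab
  | succ m ih =>
    obtain ⟨w', hsw, hs⟩ := h
    have hl : w'.length = w.length := by
      obtain ⟨X, B, Y, C, Z, rfl, rfl⟩ := hsw
      simp only [List.length_append]
      omega
    obtain ⟨P', rfl, hs', hp, hmono⟩ := ih w' (hl.trans hlen) hs
    obtain ⟨P, hsw', rfl, hperm⟩ := hsw.symm.exists_of_map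
    refine ⟨P, rfl, ⟨_, hsw'.symm.map _, hs'⟩, (hperm.map _).trans hp, ?_⟩
    intro p hpP q hqP
    exact hmono p (hperm.mem_iff.1 hpP) q (hperm.mem_iff.1 hqP)

end Lift

/-! ### Instances with a prescribed comparison pattern -/

section Instances

theorem exists_append_of_pairwise_map {κ : Type*} (g : κ → Bool) (l : List κ)
    (h : (l.map g).Pairwise (· ≤ ·)) :
    ∃ l₁ l₂, l = l₁ ++ l₂ ∧ (∀ x ∈ l₁, g x = false) ∧ ∀ x ∈ l₂, g x = true := by
  induction l with
  | nil => exact ⟨[], [], rfl, by simp, by simp⟩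
  | cons a l ih =>
    rw [List.map_cons, List.pairwise_cons] at h
    cases ha : g a
    · obtain ⟨l₁, l₂, rfl, h₁, h₂⟩ := ih h.2
      exact ⟨a :: l₁, l₂, rfl, by simpa [ha] using h₁, h₂⟩
    · refine ⟨[], a :: l, rfl, by simp, ?_⟩
      intro x hx
      rcases List.mem_cons.1 hx with rfl | hx
      · exact ha
      · have := h.1 (g x) (List.mem_map_of_mem hx)
        rw [ha] at this
        exact Bool.eq_true_of_true_le this

/-- A word in `0`, `1`, `2` with a single `1` whose `2`s are all at the end is sorted by moving
the `1` past the `0`s that follow it. -/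
theorem sortableIn_one_of_sorted_two (P : List ℕ) (hP : ∀ x ∈ P, x ≤ 2) (hc : P.count 1 = 1)
    (h : (P.map fun x => decide (2 ≤ x)).Pairwise (· ≤ ·)) : SortableIn 1 P := by
  obtain ⟨l₁, l₂, rfl, h₁, h₂⟩ := exists_append_of_pairwise_map _ P h
  have hn : 1 ∉ l₂ := fun h => by simpa using h₂ 1 h
  rw [List.count_append, List.count_eq_zero_of_not_mem hn, add_zero] at hc
  obtain ⟨X, Y, rfl⟩ := List.append_of_mem (List.count_pos_iff.1 (by omega : 0 < l₁.count 1))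
  simp only [List.count_append, List.count_cons_self] at hc
  have hX : 1 ∉ X := fun h => by have := List.count_pos_iff.2 h; omega
  have hY : 1 ∉ Y := fun h => by have := List.count_pos_iff.2 h; omega
  simp only [decide_eq_false_iff_not, decide_eq_true_eq, List.mem_append, List.mem_cons]
    at h₁ h₂ hP
  have hX0 : ∀ x ∈ X, x = 0 := fun x hx => by
    have := h₁ x (Or.inl hx)
    have : x ≠ 1 := fun h => hX (h ▸ hx)
    omega
  have hY0 : ∀ x ∈ Y, x = 0 := fun x hx => by
    have := h₁ x (Or.inr (Or.inr hx))
    have : x ≠ 1 := fun h => hY (h ▸ hx)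
    omega
  have h2 : ∀ x ∈ l₂, x = 2 := fun x hx => by
    have := h₂ x hx
    have := hP x (Or.inr hx)
    omega
  refine ⟨X ++ (Y ++ (1 :: l₂)), ⟨X, [1], [], Y, l₂, by simp, by simp⟩, ?_⟩
  simp only [SortableIn, List.pairwise_append, List.pairwise_cons, List.mem_append, List.mem_cons]
  refine ⟨?_, ⟨?_, ⟨?_, ?_⟩, ?_⟩, ?_⟩
  · exact List.pairwise_of_forall_mem_list fun a ha b hb => by rw [hX0 a ha, hX0 b hb]
  · exact List.pairwise_of_forall_mem_list fun a ha b hb => by rw [hY0 a ha, hY0 b hb]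
  · intro a ha
    rw [h2 a ha]
    norm_num
  · exact List.pairwise_of_forall_mem_list fun a ha b hb => by rw [h2 a ha, h2 b hb]
  · intro a ha b _
    rw [hY0 a ha]
    exact Nat.zero_le b
  · intro a ha b _
    rw [hX0 a ha]
    exact Nat.zero_le b

variable {α : Type*} [LinearOrder α] [Infinite α]

theorem exists_strictMono_fin (α : Type*) [LinearOrder α] [Infinite α] (n : ℕ) :
    ∃ φ : Fin n → α, StrictMono φ := by
  obtain ⟨s, hs⟩ := Infinite.exists_subset_card_eq α n
  exact ⟨s.orderEmbOfFin hs, (s.orderEmbOfFin hs).strictMono⟩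

/-- A pattern `f` of smaller (`false`) and larger (`true`) entries with at most `2 * m` descents in
which exactly `i` entries besides `i` itself are smaller is realised by an array with target at
`i` that needs at most `m + 1` block swaps: `m` swaps sort the pattern, the last one puts the
target at the end of the smaller entries. -/
theorem exists_isInstance_of_pattern {n m k : ℕ} (f : ℕ → Bool) (i : Fin n)
    (hfi : f i = false)
    (hcount : ((Finset.range n).filter fun x => f x = false).card = i + 1)
    (hdesc : ((Finset.range (n - 1)).filter fun x => f x = true ∧ f (x + 1) = false).card ≤ 2 * m)
    (hm : m + 1 ≤ k) :
    ∃ A : Fin n → α, IsInstance k A i ∧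
      ∀ j, j ≠ i → compare (A j) (A i) = if f j = true then .gt else .lt := by
  let key : ℕ → ℕ := fun x => if f x = true then 2 else if x = i then 1 else 0
  have hmap : ((List.range n).map key).map (fun x => decide (2 ≤ x)) = (List.range n).map f := by
    rw [List.map_map]
    refine List.map_congr_left fun x _ => ?_
    cases hx : f x <;> by_cases hxi : x = i <;> simp [key, hx, hxi]
    · simp [hfi]
    · simp [hxi, hfi] at hx
  have hsort : SortableIn (1 + m) ((List.range n).map key) := by
    refine SortableIn.add_of_map (fun x => decide (2 ≤ x)) 1 m _ ?_ ?_
    · rw [hmap]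
      have hn : n - 1 + 1 = n := by have := i.2; omega
      have := sortableIn_of_card_descents_le f (n - 1) m hdesc
      rwa [hn] at this
    · intro P' hP' hs
      refine sortableIn_one_of_sorted_two P' ?_ ?_ hs
      · intro x hx
        obtain ⟨y, -, rfl⟩ := List.mem_map.1 (hP'.mem_iff.1 hx)
        simp only [key]
        split_ifs <;> omega
      · rw [hP'.count_eq, List.count, List.countP_map,
          List.countP_congr (q := fun x => x == (i : ℕ))]
        · exact List.count_eq_one_of_mem List.nodup_range (by simp)
        · intro x _
          by_cases hxi : x = i
          · simp [key, hxi, hfi]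
          · cases hx : f x <;> simp [key, hxi, hx]
  obtain ⟨φ, hφ⟩ := exists_strictMono_fin α n
  obtain ⟨P, hfst, hsnd, hperm, hmono⟩ := hsort.exists_labelling (List.ofFn φ)
    (List.pairwise_ofFn.2 fun _ _ h => hφ h) _ _ (by simp)
  have hlen : P.length = n := by simpa using congrArg List.length hfst
  let A : Fin n → α := fun j => (P[(j : ℕ)]'(hlen ▸ j.2)).2
  have hA : List.ofFn A = P.map Prod.snd :=
    List.ext_getElem (by simp [hlen]) fun j _ _ => by simp [A]
  have hkey : ∀ j : Fin n, (P[(j : ℕ)]'(hlen ▸ j.2)).1 = key j := by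
    intro j
    have h1 : (P.map Prod.fst)[(j : ℕ)]? = ((List.range n).map key)[(j : ℕ)]? := by rw [hfst]
    have hj : (j : ℕ) < P.length := hlen ▸ j.2
    simpa [hj] using h1
  have hlt : ∀ a b : Fin n, key a < key b → A a < A b := by
    intro a b hab
    refine hmono _ (List.getElem_mem _) _ (List.getElem_mem _) ?_
    rwa [hkey, hkey]
  have hki : key i = 1 := by simp [key, hfi]
  have hsmall : ∀ j : Fin n, j ≠ i → f j = false → A j < A i := by
    intro j hj hf
    apply hlt
    rw [hki]
    simp [key, hf, Fin.val_ne_of_ne hj]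
  have hlarge : ∀ j : Fin n, f j = true → A i < A j := by
    intro j hf
    apply hlt
    rw [hki]
    simp [key, hf]
  refine ⟨A, ⟨?_, ?_, ?_⟩, ?_⟩
  · rw [← List.nodup_ofFn, hA, hperm.nodup_iff, List.nodup_ofFn]
    exact hφ.injective
  · refine (Nat.sInf_le ?_).trans ((Nat.add_comm 1 m).le.trans hm)
    rw [Set.mem_ofPred_eq, hA]
    exact hsnd
  · rw [rank, ← hcount]
    have h1 : (Finset.univ.filter fun j => A j < A i).card + 1 =
        (Finset.univ.filter fun j : Fin n => f j = false).card := by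
      rw [← Finset.card_insert_of_notMem (a := i) (by simp)]
      congr 1
      ext j
      simp only [Finset.mem_insert, Finset.mem_filter, Finset.mem_univ, true_and]
      constructor
      · rintro (rfl | h)
        · exact hfi
        · cases hf : f j
          · rfl
          · exact absurd h (hlarge j hf).not_gt
      · intro hf
        by_cases hj : j = i
        · exact Or.inl hj
        · exact Or.inr (hsmall j hj hf)
    rw [h1, ← Finset.card_map Fin.valEmbedding]
    congr 1
    ext x
    simp only [Finset.mem_map, Finset.mem_filter, Finset.mem_range, Finset.mem_univ, true_and,
      Fin.valEmbedding_apply]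
    constructor
    · rintro ⟨hx, hf⟩
      exact ⟨⟨x, hx⟩, hf, rfl⟩
    · rintro ⟨j, hf, rfl⟩
      exact ⟨j.2, hf⟩
  · intro j hj
    cases hf : f j
    · simpa using compare_lt_iff_lt.2 (hsmall j hj hf)
    · simpa using compare_gt_iff_gt.2 (hlarge j hf)

theorem exists_isInstance (α : Type*) [LinearOrder α] [Infinite α] {n : ℕ} (k : ℕ) (hn : 1 ≤ n) :
    ∃ (A : Fin n → α) (i : Fin n), IsInstance k A i := by
  obtain ⟨φ, hφ⟩ := exists_strictMono_fin α n
  refine ⟨φ, ⟨0, hn⟩, hφ.injective, ?_, ?_⟩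
  · refine (Nat.sInf_le ?_).trans (Nat.zero_le k)
    exact List.pairwise_ofFn.2 fun _ _ h => (hφ h).le
  · have : (Finset.univ.filter fun j => φ j < φ ⟨0, hn⟩) = ∅ := by
      ext j
      simp [hφ.lt_iff_lt, Fin.lt_def]
    simp [rank, this]

end Instances

/-! ### Unions of few runs in the complement of a finite set -/

section Runs

/-- The first elements of the maximal runs of consecutive numbers in `F`. -/
def runStarts (F : Finset ℕ) : Finset ℕ :=
  F.filter fun x => ∀ y ∈ F, y + 1 ≠ x

theorem mem_runStarts {F : Finset ℕ} {x : ℕ} :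
    x ∈ runStarts F ↔ x ∈ F ∧ ∀ y ∈ F, y + 1 ≠ x := by
  simp [runStarts]

theorem card_runStarts_erase_le (F : Finset ℕ) (p : ℕ) :
    (runStarts (F.erase p)).card ≤ (runStarts F).card + 1 := by
  refine (Finset.card_le_card (t := insert (p + 1) (runStarts F)) ?_).trans
    (Finset.card_insert_le _ _)
  intro x hx
  simp only [mem_runStarts, Finset.mem_insert, Finset.mem_erase] at hx ⊢
  grind

theorem card_runStarts_insert_le (F : Finset ℕ) (p : ℕ) :
    (runStarts (insert p F)).card ≤ (runStarts F).card + 1 := by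
  refine (Finset.card_le_card (t := insert p (runStarts F)) ?_).trans
    (Finset.card_insert_le _ _)
  intro x hx
  simp only [mem_runStarts, Finset.mem_insert] at hx ⊢
  grind

/-- Initial segments of a set do not have more runs than the set. -/
theorem exists_subset_card_eq_of_runStarts (F : Finset ℕ) (t : ℕ) (ht : t ≤ F.card) :
    ∃ F' ⊆ F, F'.card = t ∧ (runStarts F').card ≤ (runStarts F).card := by
  induction F using Finset.induction_on_max with
  | empty => exact ⟨∅, by simp, by simpa [eq_comm] using ht, le_rfl⟩
  | insert a F ha ih =>
    have hnot : a ∉ F := fun h => lt_irrefl _ (ha a h)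
    rw [Finset.card_insert_of_notMem hnot] at ht
    rcases ht.eq_or_lt with rfl | ht
    · exact ⟨insert a F, subset_rfl, Finset.card_insert_of_notMem hnot, le_rfl⟩
    · obtain ⟨F', hF', hc, hr⟩ := ih (by omega)
      refine ⟨F', hF'.trans (Finset.subset_insert _ _), hc, hr.trans (Finset.card_le_card ?_)⟩
      intro x hx
      simp only [mem_runStarts, Finset.mem_insert] at hx ⊢
      refine ⟨Or.inr hx.1, ?_⟩
      rintro y (rfl | hy) rfl
      · have := ha _ hx.1
        omega
      · exact hx.2 y hy rfl

/-- The average over the `K` largest values is at least the average over all values. -/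
theorem exists_subset_card_eq_sum_ge {ι : Type*} [DecidableEq ι] (s : ι → ℕ) (K : ℕ)
    (J : Finset ι) (hK : K ≤ J.card) :
    ∃ J' ⊆ J, J'.card = K ∧ K * ∑ j ∈ J, s j ≤ J.card * ∑ j ∈ J', s j := by
  obtain ⟨d, hd⟩ := Nat.exists_eq_add_of_le hK
  induction d generalizing J with
  | zero => exact ⟨J, subset_rfl, hd, by rw [hd]; simp⟩
  | succ d ih =>
    have hne : J.Nonempty := Finset.card_pos.1 (by omega)
    obtain ⟨a, ha, hmin⟩ := Finset.exists_min_image J s hne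
    have hcard : (J.erase a).card = K + d := by rw [Finset.card_erase_of_mem ha]; omega
    obtain ⟨J', hJ', hc, hsum⟩ := ih (J.erase a) (by omega) hcard
    refine ⟨J', hJ'.trans (Finset.erase_subset _ _), hc, ?_⟩
    rw [hcard] at hsum
    rw [hd, ← Finset.add_sum_erase J s ha]
    have h1 : (K + d) * s a ≤ ∑ j ∈ J.erase a, s j := by
      have := Finset.card_nsmul_le_sum (J.erase a) s (s a)
        fun x hx => hmin x (Finset.mem_of_mem_erase hx)
      rwa [hcard, smul_eq_mul] at this
    rcases Nat.eq_zero_or_pos K with rfl | hKpos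
    · simp
    · refine Nat.le_of_mul_le_mul_left ?_ (show 0 < K + d by omega)
      nlinarith [Nat.mul_le_mul_left K h1, Nat.mul_le_mul_left (K + d + 1) hsum]

/-- Among the at most `q + 1` gaps that `q` points leave in an interval, the `K` longest ones
together contain at least the proportion `K / (q + 1 + K)` of the remaining points. -/
theorem exists_few_runs_large (Q : Finset ℕ) (W M K : ℕ) :
    ∃ F ⊆ Finset.Ico W M \ Q, (runStarts F).card ≤ K ∧
      K * (Finset.Ico W M \ Q).card ≤ ((Finset.Ico W M ∩ Q).card + 1 + K) * F.card := by
  set U := Finset.Ico W M \ Q with hU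
  set R := Finset.Ico W M ∩ Q with hR
  -- `g x` is the index of the gap that contains `x`.
  let g : ℕ → ℕ := fun x => (R.filter fun y => y < x).card
  have hg : ∀ x ∈ U, g x ∈ Finset.range (R.card + 1 + K) := by
    intro x _
    have : g x ≤ R.card := Finset.card_filter_le _ _
    rw [Finset.mem_range]
    omega
  obtain ⟨J, -, hJc, hJ⟩ := exists_subset_card_eq_sum_ge
    (fun j => (U.filter fun x => g x = j).card) K (Finset.range (R.card + 1 + K)) (by simp)
  rw [← Finset.card_eq_sum_card_fiberwise hg, Finset.card_range] at hJ
  refine ⟨U.filter fun x => g x ∈ J, Finset.filter_subset _ _, ?_, ?_⟩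
  · rw [← hJc]
    refine Finset.card_le_card_of_injOn g ?_ ?_
    · intro x hx
      exact (Finset.mem_filter.1 (mem_runStarts.1 hx).1).2
    · -- Of two elements of the same gap, the larger one has its predecessor in the same gap.
      have key : ∀ x ∈ runStarts (U.filter fun x => g x ∈ J),
          ∀ y ∈ runStarts (U.filter fun x => g x ∈ J), g x = g y → ¬ x < y := by
        intro x hx y hy hxy hlt
        rw [mem_runStarts, Finset.mem_filter] at hx hy
        have hmono : ∀ a b : ℕ, a ≤ b → g a ≤ g b := fun a b hab =>
          Finset.card_le_card fun z hz => by
            simp only [Finset.mem_filter] at hz ⊢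
            exact ⟨hz.1, hz.2.trans_le hab⟩
        have h1 : g (y - 1) = g y :=
          le_antisymm (hmono _ _ (by omega)) (hxy ▸ hmono _ _ (by omega))
        have hx1 := hx.1.1
        have hy1 := hy.1.1
        simp only [hU, Finset.mem_sdiff, Finset.mem_Ico] at hx1 hy1
        have h2 : y - 1 ∉ Q := by
          intro hq
          have hyR : y - 1 ∈ R := by
            simp only [hR, Finset.mem_inter, Finset.mem_Ico]
            exact ⟨by omega, hq⟩
          have : g (y - 1) < g y := by
            refine Finset.card_lt_card ((Finset.ssubset_iff_of_subset ?_).2 ⟨y - 1, ?_, ?_⟩)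
            · intro z hz
              simp only [Finset.mem_filter] at hz ⊢
              exact ⟨hz.1, by omega⟩
            · simp only [Finset.mem_filter]
              exact ⟨hyR, by omega⟩
            · simp
          omega
        refine hy.2 (y - 1) ?_ (by omega)
        rw [Finset.mem_filter, h1]
        refine ⟨?_, hy.1.2⟩
        simp only [hU, Finset.mem_sdiff, Finset.mem_Ico]
        exact ⟨by omega, h2⟩
      intro x hx y hy hxy
      rcases lt_trichotomy x y with h | h | h
      · exact absurd h (key x hx y hy hxy)
      · exact h
      · exact absurd h (key y hy x hx hxy.symm)
  · refine hJ.trans (le_of_eq ?_)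
    congr 1
    rw [Finset.card_eq_sum_card_fiberwise (f := g) (t := J)]
    · refine Finset.sum_congr rfl fun j hj => ?_
      congr 1
      ext x
      simp only [Finset.mem_filter]
      constructor
      · rintro ⟨h, rfl⟩
        exact ⟨⟨h, hj⟩, rfl⟩
      · rintro ⟨⟨h, _⟩, h'⟩
        exact ⟨h, h'⟩
    · intro x hx
      exact (Finset.mem_filter.1 hx).2

/-- Let `W` be the largest size of a union of at most `K` runs avoiding `Q` in `[0, M)`. Every point
`p < W` outside `Q` admits a set of exactly `p` points that avoids `Q` and `p` and has at most
`K + 1` runs; on the other hand, `Q` has to meet `[W, M)` often, since all of its gaps there are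
accounted for by `W`. -/
theorem exists_threshold (Q : Finset ℕ) (M K : ℕ) :
    ∃ W ≤ M, (∀ p ∈ Finset.range W \ Q, ∃ F ⊆ Finset.range M \ Q, p ∉ F ∧ F.card = p ∧
        (runStarts F).card ≤ K + 1) ∧
      K * (Finset.Ico W M \ Q).card ≤ ((Finset.Ico W M ∩ Q).card + 1 + K) * W := by
  classical
  let P : ℕ → Prop := fun t => ∃ F ⊆ Finset.range M \ Q, F.card = t ∧ (runStarts F).card ≤ K
  have hP : P (Nat.findGreatest P M) :=
    Nat.findGreatest_spec (Nat.zero_le M) ⟨∅, by simp, by simp, by simp [runStarts]⟩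
  refine ⟨Nat.findGreatest P M, Nat.findGreatest_le M, ?_, ?_⟩
  · intro p hp
    simp only [Finset.mem_sdiff, Finset.mem_range] at hp
    obtain ⟨F, hF, hc, hr⟩ := hP
    have h1 : p ≤ (F.erase p).card := by
      have := Finset.pred_card_le_card_erase (s := F) (a := p)
      omega
    obtain ⟨F', hF', hc', hr'⟩ := exists_subset_card_eq_of_runStarts (F.erase p) p h1
    refine ⟨F', hF'.trans ((Finset.erase_subset _ _).trans hF), ?_, hc', ?_⟩
    · intro h
      simpa using hF' h
    · have := card_runStarts_erase_le F p
      omega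
  · obtain ⟨F, hF, hr, hc⟩ := exists_few_runs_large Q (Nat.findGreatest P M) M K
    have hsub : F ⊆ Finset.range M \ Q := by
      refine hF.trans (Finset.sdiff_subset_sdiff ?_ subset_rfl)
      intro x hx
      simp only [Finset.mem_Ico, Finset.mem_range] at hx ⊢
      exact hx.2
    refine hc.trans (Nat.mul_le_mul_left _ (Nat.le_findGreatest ?_ ⟨F, hsub, rfl, hr⟩))
    simpa using Finset.card_le_card (hsub.trans Finset.sdiff_subset)

end Runs

/-! ### Targets consistent with the reference answers -/

section Consistent

/-- The answers of the oblivious adversary: entries before index `m` are smaller than the target and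
all others are larger. -/
def refAnswer (m j : ℕ) : Ordering := if m ≤ j then .gt else .lt

/-- Some instance with target at index `i` gives the reference answers to all queries in `Q`. -/
def IsConsistent (α : Type*) [LinearOrder α] {n : ℕ} (m k : ℕ) (Q : Finset (Fin n)) (i : Fin n) :
    Prop :=
  ∃ A : Fin n → α, IsInstance k A i ∧ ∀ j ∈ Q, compare (A j) (A i) = refAnswer m j

variable (α : Type*) [LinearOrder α] [Infinite α]

/-- To place the target `p` steps before the last index below `m`, `p` unqueried entries below `m`
are declared larger than the target; `F` is the set of their distances to `m - 1`. -/
theorem isConsistent_left {n m k p : ℕ} (hm : m ≤ n) (hp : p < m) (hk : 1 ≤ k)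
    (Q : Finset (Fin n)) (F : Finset ℕ) (hF : F ⊆ Finset.range m) (hpF : p ∉ F) (hc : F.card = p)
    (hr : (runStarts F).card ≤ 2 * (k - 1))
    (hQ : ∀ j ∈ Q, (j : ℕ) < m → m - 1 - j ∉ insert p F) :
    IsConsistent α m k Q ⟨m - 1 - p, by omega⟩ := by
  refine (exists_isInstance_of_pattern (α := α) (m := k - 1) (k := k)
    (fun x => decide (m ≤ x ∨ m - 1 - x ∈ F)) (⟨m - 1 - p, by omega⟩ : Fin n) ?_ ?_ ?_ (by omega)).imp
    fun A ⟨hA, hcmp⟩ => ⟨hA, fun j hj => ?_⟩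
  · have h : m - 1 - (m - 1 - p) = p := by omega
    simp only [h, hpF, or_false, decide_eq_false_iff_not, not_le]
    omega
  · have h : ((Finset.range n).filter fun x => decide (m ≤ x ∨ m - 1 - x ∈ F) = false) =
        (Finset.range m \ F).image fun y => m - 1 - y := by
      ext x
      simp only [Finset.mem_filter, Finset.mem_range, decide_eq_false_iff_not, not_or, not_le,
        Finset.mem_image, Finset.mem_sdiff]
      constructor
      · rintro ⟨-, h1, h2⟩
        exact ⟨m - 1 - x, ⟨by omega, h2⟩, by omega⟩
      · rintro ⟨y, ⟨h1, h2⟩, rfl⟩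
        have : m - 1 - (m - 1 - y) = y := by omega
        exact ⟨by omega, by omega, by rwa [this]⟩
    rw [h, Finset.card_image_of_injOn, Finset.card_sdiff_of_subset hF, hc, Finset.card_range]
    · simp only
      omega
    · intro x hx y hy hxy
      simp only [Finset.coe_sdiff, Finset.coe_range, Set.mem_sdiff, Set.mem_Iio] at hx hy hxy
      omega
  · refine (Finset.card_le_card_of_injOn (fun x => m - 1 - x) ?_ ?_).trans hr
    · intro x hx
      simp only [Finset.coe_filter, Finset.mem_range, decide_eq_true_eq, decide_eq_false_iff_not,
        not_or, not_le, Set.mem_ofPred_eq] at hx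
      obtain ⟨-, h1, h2, h3⟩ := hx
      rw [Finset.mem_coe, mem_runStarts]
      beta_reduce
      refine ⟨h1.resolve_left (by omega), fun y hy hxy => h3 ?_⟩
      have : m - 1 - (x + 1) = y := by omega
      rwa [this]
    · intro x hx y hy hxy
      simp only [Finset.coe_filter, Finset.mem_range, decide_eq_true_eq, decide_eq_false_iff_not,
        not_or, not_le, Set.mem_ofPred_eq] at hx hy hxy
      omega
  · have hQj := hQ j hj
    rw [Finset.mem_insert, not_or] at hQj
    rw [hcmp j, refAnswer]
    · by_cases h : m ≤ (j : ℕ)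
      · simp [h]
      · simp [h, (hQj (not_le.1 h)).2]
    · rintro rfl
      simp only at hQj
      omega

/-- To place the target at index `m + p`, `p` unqueried entries from index `m` on are declared
smaller than the target; `F` is the set of their distances to `m`. -/
theorem isConsistent_right {n m k p : ℕ} (hp : m + p < n) (hk : 1 ≤ k)
    (Q : Finset (Fin n)) (F : Finset ℕ) (hF : F ⊆ Finset.range (n - m)) (hpF : p ∉ F)
    (hc : F.card = p) (hr : (runStarts F).card + 1 ≤ 2 * (k - 1))
    (hQ : ∀ j ∈ Q, m ≤ (j : ℕ) → (j : ℕ) - m ∉ insert p F) :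
    IsConsistent α m k Q ⟨m + p, hp⟩ := by
  refine (exists_isInstance_of_pattern (α := α) (m := k - 1) (k := k)
    (fun x => decide (m ≤ x ∧ x - m ∉ insert p F)) (⟨m + p, hp⟩ : Fin n) ?_ ?_ ?_ (by omega)).imp
    fun A ⟨hA, hcmp⟩ => ⟨hA, fun j hj => ?_⟩
  · simp
  · have h : ((Finset.range n).filter fun x => decide (m ≤ x ∧ x - m ∉ insert p F) = false) =
        Finset.range m ∪ (insert p F).image fun y => m + y := by
      ext x
      simp only [Finset.mem_filter, Finset.mem_range, decide_eq_false_iff_not, not_and, not_not,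
        Finset.mem_image, Finset.mem_union]
      constructor
      · rintro ⟨-, h1⟩
        by_cases hx : m ≤ x
        · exact Or.inr ⟨x - m, h1 hx, by omega⟩
        · exact Or.inl (by omega)
      · rintro (h1 | ⟨y, h1, rfl⟩)
        · exact ⟨by omega, fun h2 => absurd h1 h2.not_gt⟩
        · refine ⟨?_, fun _ => by rwa [Nat.add_sub_cancel_left]⟩
          rcases Finset.mem_insert.1 h1 with rfl | h1
          · exact hp
          · have := Finset.mem_range.1 (hF h1)
            omega
    rw [h, Finset.card_union_of_disjoint, Finset.card_image_of_injective _ (add_right_injective m),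
      Finset.card_insert_of_notMem hpF, hc, Finset.card_range, add_assoc]
    rw [Finset.disjoint_left]
    intro x hx hx'
    obtain ⟨y, -, rfl⟩ := Finset.mem_image.1 hx'
    simp at hx
  · refine (Finset.card_le_card_of_injOn (fun x => x + 1 - m) ?_ ?_).trans
      ((card_runStarts_insert_le F p).trans hr)
    · intro x hx
      simp only [Finset.coe_filter, Finset.mem_range, decide_eq_true_eq, decide_eq_false_iff_not,
        not_and, not_not, Set.mem_ofPred_eq] at hx
      obtain ⟨-, ⟨h1, h2⟩, h3⟩ := hx
      rw [Finset.mem_coe, mem_runStarts]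
      beta_reduce
      refine ⟨h3 (by omega), fun y hy hxy => h2 ?_⟩
      have : x - m = y := by omega
      rwa [this]
    · intro x hx y hy hxy
      simp only [Finset.coe_filter, Finset.mem_range, decide_eq_true_eq, decide_eq_false_iff_not,
        not_and, not_not, Set.mem_ofPred_eq] at hx hy hxy
      omega
  · have hQj := hQ j hj
    rw [hcmp j, refAnswer]
    · by_cases h : m ≤ (j : ℕ)
      · simp only [h, hQj h]
        simp
      · simp [h]
    · rintro rfl
      simp at hQj

/-- The cost of one side of length `M`: with `s = W + q + 1`, the inequality between arithmetic and
geometric mean gives `s ^ 2 / 4 ≥ W * (q + 1) ≥ K * (M - 2 * W - q) ≥ K * (M - 2 * s)`. -/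
theorem two_mul_sqrt_le_of_threshold {W M K : ℕ} (Q : Finset ℕ) (hW : W ≤ M) {T : ℝ}
    (h : K * (Finset.Ico W M \ Q).card ≤ ((Finset.Ico W M ∩ Q).card + 1 + K) * W)
    (hT : (W : ℝ) + (Finset.Ico W M ∩ Q).card + 1 ≤ T) :
    2 * √((K : ℝ) * (M - 2 * T)) ≤ (W : ℝ) + (Finset.Ico W M ∩ Q).card + 1 := by
  have hcard : (Finset.Ico W M \ Q).card + (Finset.Ico W M ∩ Q).card + W = M := by
    rw [Finset.card_sdiff_add_card_inter, Nat.card_Ico]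
    omega
  generalize (Finset.Ico W M \ Q).card = u at *
  generalize (Finset.Ico W M ∩ Q).card = q at *
  have hcard' : (u : ℝ) + q + W = M := by exact_mod_cast hcard
  have h' : (K : ℝ) * u ≤ (q + 1 + K) * W := by exact_mod_cast h
  have hq : (0 : ℝ) ≤ q := by positivity
  have hW0 : (0 : ℝ) ≤ W := by positivity
  have h1 : (K : ℝ) * (M - 2 * T) ≤ K * (u - W) :=
    mul_le_mul_of_nonneg_left (by linarith) (by positivity)
  have h2 : √((K : ℝ) * (M - 2 * T)) ≤ ((W : ℝ) + q + 1) / 2 := by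
    rw [Real.sqrt_le_iff]
    refine ⟨by positivity, ?_⟩
    nlinarith [sq_nonneg ((W : ℝ) - (q + 1))]
  linarith

theorem exists_two_isConsistent {n k : ℕ} (hk : 3 ≤ k) (Q : Finset (Fin n)) {T : ℝ}
    (hT : (Q.card : ℝ) + 3 ≤ T)
    (hQ : (Q.card : ℝ) + 3 < 4 * √(((2 * k - 4 : ℕ) : ℝ) * (((n : ℝ) - 1) / 2 - 2 * T))) :
    ∃ i i' : Fin n, i ≠ i' ∧ IsConsistent α (n / 2) k Q i ∧ IsConsistent α (n / 2) k Q i' := by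
  classical
  set m := n / 2 with hm
  -- The queries on either side of the centre, by their distance to the centre.
  let QL : Finset ℕ := (Q.filter fun j : Fin n => (j : ℕ) < m).image fun j : Fin n => m - 1 - (j : ℕ)
  let QR : Finset ℕ := (Q.filter fun j : Fin n => ¬ (j : ℕ) < m).image fun j : Fin n => (j : ℕ) - m
  have hQLR : QL.card + QR.card ≤ Q.card := by
    rw [← Finset.card_filter_add_card_filter_not (s := Q) fun j => (j : ℕ) < m]
    exact add_le_add Finset.card_image_le Finset.card_image_le
  obtain ⟨WL, hWL, hL, hL'⟩ := exists_threshold QL m (2 * k - 4)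
  obtain ⟨WR, hWR, hR, hR'⟩ := exists_threshold QR (n - m) (2 * k - 4)
  have hleft : ∀ p, (hp : p ∈ Finset.range WL \ QL) →
      ∃ h : m - 1 - p < n, IsConsistent α m k Q ⟨m - 1 - p, h⟩ := by
    intro p hp
    obtain ⟨F, hF, hpF, hc, hr⟩ := hL p hp
    rw [Finset.mem_sdiff, Finset.mem_range] at hp
    refine ⟨by omega, isConsistent_left α (by omega) (by omega) (by omega) Q F
      (hF.trans Finset.sdiff_subset) hpF hc (by omega) ?_⟩
    intro j hj hjm hmem
    have hjQ : m - 1 - (j : ℕ) ∈ QL :=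
      Finset.mem_image.2 ⟨j, Finset.mem_filter.2 ⟨hj, hjm⟩, rfl⟩
    rcases Finset.mem_insert.1 hmem with h | h
    · exact hp.2 (h ▸ hjQ)
    · exact (Finset.mem_sdiff.1 (hF h)).2 hjQ
  have hright : ∀ p, (hp : p ∈ Finset.range WR \ QR) →
      ∃ h : m + p < n, IsConsistent α m k Q ⟨m + p, h⟩ := by
    intro p hp
    obtain ⟨F, hF, hpF, hc, hr⟩ := hR p hp
    rw [Finset.mem_sdiff, Finset.mem_range] at hp
    refine ⟨by omega, isConsistent_right α (by omega) (by omega) Q F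
      (hF.trans Finset.sdiff_subset) hpF hc (by omega) ?_⟩
    intro j hj hjm hmem
    have hjQ : (j : ℕ) - m ∈ QR :=
      Finset.mem_image.2 ⟨j, Finset.mem_filter.2 ⟨hj, by omega⟩, rfl⟩
    rcases Finset.mem_insert.1 hmem with h | h
    · exact hp.2 (h ▸ hjQ)
    · exact (Finset.mem_sdiff.1 (hF h)).2 hjQ
  by_cases htwo : 1 < ((Finset.range WL \ QL).image (fun p => m - 1 - p) ∪
      (Finset.range WR \ QR).image (fun p => m + p)).card
  · obtain ⟨x, hx, y, hy, hxy⟩ := Finset.one_lt_card.1 htwo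
    have key : ∀ x ∈ (Finset.range WL \ QL).image (fun p => m - 1 - p) ∪
        (Finset.range WR \ QR).image (fun p => m + p),
        ∃ h : x < n, IsConsistent α m k Q ⟨x, h⟩ := by
      intro x hx
      rcases Finset.mem_union.1 hx with hx | hx
      · obtain ⟨p, hp, rfl⟩ := Finset.mem_image.1 hx
        exact hleft p hp
      · obtain ⟨p, hp, rfl⟩ := Finset.mem_image.1 hx
        exact hright p hp
    obtain ⟨hxn, hx⟩ := key x hx
    obtain ⟨hyn, hy⟩ := key y hy
    exact ⟨⟨x, hxn⟩, ⟨y, hyn⟩, fun h => hxy (congrArg Fin.val h), hx, hy⟩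
  · exfalso
    rw [Finset.card_union_of_disjoint, Finset.card_image_of_injOn,
      Finset.card_image_of_injective _ (add_right_injective m)] at htwo
    · have count : ∀ (W M : ℕ) (P : Finset ℕ),
          W + (Finset.Ico W M ∩ P).card ≤ (Finset.range W \ P).card + P.card := by
        intro W M P
        have h1 := Finset.card_sdiff_add_card_inter (Finset.range W) P
        rw [Finset.card_range] at h1
        have h2 : (Finset.range W ∩ P).card + (Finset.Ico W M ∩ P).card ≤ P.card := by
          rw [← Finset.card_union_of_disjoint]
          · exact Finset.card_le_card
              (Finset.union_subset Finset.inter_subset_right Finset.inter_subset_right)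
          · rw [Finset.disjoint_left]
            intro x hx hx'
            simp only [Finset.mem_inter, Finset.mem_range, Finset.mem_Ico] at hx hx'
            omega
        omega
      have hsum : WL + (Finset.Ico WL m ∩ QL).card + 1 + (WR + (Finset.Ico WR (n - m) ∩ QR).card + 1)
          ≤ Q.card + 3 := by
        have h1 := count WL m QL
        have h2 := count WR (n - m) QR
        omega
      have hsum' : (WL : ℝ) + (Finset.Ico WL m ∩ QL).card + 1 +
          (WR + (Finset.Ico WR (n - m) ∩ QR).card + 1) ≤ Q.card + 3 := by exact_mod_cast hsum
      have hL0 : (0 : ℝ) ≤ (WL : ℝ) + (Finset.Ico WL m ∩ QL).card + 1 := by positivity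
      have hR0 : (0 : ℝ) ≤ (WR : ℝ) + (Finset.Ico WR (n - m) ∩ QR).card + 1 := by positivity
      have hbL := two_mul_sqrt_le_of_threshold (T := T) QL hWL hL' (by linarith)
      have hbR := two_mul_sqrt_le_of_threshold (T := T) QR hWR hR' (by linarith)
      have hhalf : ∀ M : ℕ, n ≤ 2 * M + 1 →
          √(((2 * k - 4 : ℕ) : ℝ) * (((n : ℝ) - 1) / 2 - 2 * T)) ≤
            √(((2 * k - 4 : ℕ) : ℝ) * (M - 2 * T)) := by
        intro M hM
        have hM' : (n : ℝ) ≤ 2 * M + 1 := by exact_mod_cast hM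
        exact Real.sqrt_le_sqrt (mul_le_mul_of_nonneg_left (by linarith) (by positivity))
      have h1 := hhalf m (by omega)
      have h2 := hhalf (n - m) (by omega)
      linarith
    · intro x hx y hy hxy
      simp only [Finset.coe_sdiff, Finset.coe_range, Set.mem_sdiff, Set.mem_Iio] at hx hy hxy
      omega
    · rw [Finset.disjoint_left]
      intro x hx hx'
      obtain ⟨p, hp, rfl⟩ := Finset.mem_image.1 hx
      obtain ⟨p', -, h⟩ := Finset.mem_image.1 hx'
      rw [Finset.mem_sdiff, Finset.mem_range] at hp
      omega

end Consistent

/-! ### The adversary -/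

section Adversary

/-- Against reference answers, an algorithm either survives `b` queries, or its answer is determined
by the answers to at most `b` queries. -/
theorem SearchAlg.exists_queries {n : ℕ} (α : Type*) [LinearOrder α] (S : SearchAlg n)
    (ref : Fin n → Ordering) (b : ℕ) :
    ∃ Q : Finset (Fin n), Q.card ≤ b ∧
      ((∀ (A : Fin n → α) (e : α), (∀ j ∈ Q, compare (A j) e = ref j) → b ≤ S.numQueries A e) ∨
        ∃ ans, ∀ (A : Fin n → α) (e : α), (∀ j ∈ Q, compare (A j) e = ref j) →
          S.run A e = ans) := by
  induction S generalizing b with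
  | answer ans => exact ⟨∅, by simp, Or.inr ⟨ans, fun _ _ _ => rfl⟩⟩
  | query i next ih =>
    rcases b with _ | b
    · exact ⟨∅, by simp, Or.inl fun _ _ _ => Nat.zero_le _⟩
    · obtain ⟨Q, hQ, h⟩ := ih (ref i) b
      refine ⟨insert i Q, (Finset.card_insert_le _ _).trans (by omega), ?_⟩
      refine h.imp (fun h A e hA => ?_) fun ⟨ans, h⟩ => ⟨ans, fun A e hA => ?_⟩
      · rw [numQueries, hA i (Finset.mem_insert_self i Q)]
        exact Nat.succ_le_succ (h A e fun j hj => hA j (Finset.mem_insert_of_mem hj))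
      · rw [run, hA i (Finset.mem_insert_self i Q)]
        exact h A e fun j hj => hA j (Finset.mem_insert_of_mem hj)

/-- An explicit lower bound on the number of queries, asymptotically equal to `4 * √(n * k)`. -/
noncomputable def queryBound (n k : ℕ) : ℝ :=
  4 * √(((2 * k - 4 : ℕ) : ℝ) * (((n : ℝ) - 1) / 2 - 2 * (4 * √((n : ℝ) * k)))) - 5

theorem exists_queryBound_le {α : Type*} [LinearOrder α] [Infinite α] {n k : ℕ} (hn : 1 ≤ n)
    (S : SearchAlg n) (hS : S.FindsTarget α k) :
    ∃ (A : Fin n → α) (i : Fin n), IsInstance k A i ∧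
      queryBound n k ≤ (S.numQueries A (A i) : ℝ) := by
  rcases le_or_gt (queryBound n k) 0 with hB | hB
  · obtain ⟨A, i, hA⟩ := exists_isInstance α k hn
    exact ⟨A, i, hA, hB.trans (Nat.cast_nonneg _)⟩
  have hk : 3 ≤ k := by
    by_contra hk
    have h0 : 2 * k - 4 = 0 := by omega
    norm_num [queryBound, h0] at hB
  obtain ⟨Q, hQ, h⟩ := S.exists_queries α (fun j => refAnswer (n / 2) j) ⌈queryBound n k⌉₊
  have hceil := Nat.ceil_lt_add_one hB.le
  have hQ' : (Q.card : ℝ) ≤ (⌈queryBound n k⌉₊ : ℝ) := by exact_mod_cast hQ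
  have hlt : (Q.card : ℝ) < queryBound n k + 1 := hQ'.trans_lt hceil
  have hle : queryBound n k + 5 ≤ 4 * √((n : ℝ) * k) := by
    rw [queryBound, sub_add_cancel]
    refine mul_le_mul_of_nonneg_left (Real.sqrt_le_sqrt ?_) (by norm_num)
    have h1 : ((2 * k - 4 : ℕ) : ℝ) ≤ 2 * k := by exact_mod_cast Nat.sub_le _ _
    have h2 : ((n : ℝ) - 1) / 2 - 2 * (4 * √((n : ℝ) * k)) ≤ n / 2 := by
      have := Real.sqrt_nonneg ((n : ℝ) * k)
      linarith
    calc _ ≤ ((2 * k - 4 : ℕ) : ℝ) * (n / 2) := mul_le_mul_of_nonneg_left h2 (by positivity)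
      _ ≤ 2 * k * (n / 2) := mul_le_mul_of_nonneg_right h1 (by positivity)
      _ = n * k := by ring
  obtain ⟨i, i', hne, ⟨A, hA, hAQ⟩, ⟨A', hA', hAQ'⟩⟩ :=
    exists_two_isConsistent α hk Q (T := 4 * √((n : ℝ) * k)) (by linarith)
      (by rw [queryBound] at hlt; linarith)
  rcases h with h | ⟨ans, h⟩
  · refine ⟨A, i, hA, (Nat.le_ceil _).trans ?_⟩
    exact_mod_cast h A (A i) hAQ
  · exact absurd (Option.some_injective _ <| (hS A i hA).symm.trans <|
      (h A (A i) hAQ).trans <| (h A' (A' i') hAQ').symm.trans (hS A' i' hA')) hne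

end Adversary

/-! ### Asymptotics -/

section Asymptotics

open Filter Topology

theorem isLittleO_sub_queryBound :
    (fun p : ℕ × ℕ => 4 * √((p.1 : ℝ) * p.2) - queryBound p.1 p.2) =o[regime]
      fun p : ℕ × ℕ => √((p.1 : ℝ) * p.2) := by
  have hk : Tendsto (fun p : ℕ × ℕ => p.2) regime atTop := tendsto_comap.mono_left inf_le_left
  have hkR : Tendsto (fun p : ℕ × ℕ => (p.2 : ℝ)) regime atTop :=
    tendsto_natCast_atTop_atTop.comp hk
  have hnk : Tendsto (fun p : ℕ × ℕ => (p.1 : ℝ) / p.2) regime atTop :=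
    tendsto_comap.mono_left inf_le_right
  have hpos : ∀ᶠ p : ℕ × ℕ in regime, 2 ≤ p.2 ∧ (0 : ℝ) < p.1 := by
    filter_upwards [hk.eventually_ge_atTop 2, hnk.eventually_gt_atTop 0] with p h1 h2
    refine ⟨h1, ?_⟩
    by_contra h
    have : (p.1 : ℝ) = 0 := le_antisymm (not_lt.1 h) (Nat.cast_nonneg _)
    simp [this] at h2
  have hn : Tendsto (fun p : ℕ × ℕ => (p.1 : ℝ)) regime atTop := by
    refine (hkR.atTop_mul_atTop₀ hnk).congr' ?_
    filter_upwards [hpos] with p hp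
    have : (p.2 : ℝ) ≠ 0 := by have := hp.1; positivity
    field_simp
  have hkinv : Tendsto (fun p : ℕ × ℕ => (p.2 : ℝ)⁻¹) regime (𝓝 0) := hkR.inv_tendsto_atTop
  have hninv : Tendsto (fun p : ℕ × ℕ => (p.1 : ℝ)⁻¹) regime (𝓝 0) := hn.inv_tendsto_atTop
  have hsqrt : Tendsto (fun p : ℕ × ℕ => √(((p.1 : ℝ) / p.2)⁻¹)) regime (𝓝 0) := by
    simpa using hnk.inv_tendsto_atTop.sqrt
  have hs : Tendsto (fun p : ℕ × ℕ => (√((p.1 : ℝ) * p.2))⁻¹) regime (𝓝 0) :=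
    (Real.tendsto_sqrt_atTop.comp (hn.atTop_mul_atTop₀ hkR)).inv_tendsto_atTop
  -- The quotient tends to `4 - 4 * √(2 * (1 / 2)) + 5 * 0 = 0`.
  have hlim : Tendsto (fun p : ℕ × ℕ => 4 - 4 * √((2 - 4 * (p.2 : ℝ)⁻¹) *
      ((1 - (p.1 : ℝ)⁻¹) / 2 - 8 * √(((p.1 : ℝ) / p.2)⁻¹))) + 5 * (√((p.1 : ℝ) * p.2))⁻¹)
      regime (𝓝 0) := by
    have h1 := (tendsto_const_nhds (x := (2 : ℝ))).sub (hkinv.const_mul 4)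
    have h2 := (((tendsto_const_nhds (x := (1 : ℝ))).sub hninv).div_const 2).sub
      (hsqrt.const_mul 8)
    have h3 := ((tendsto_const_nhds (x := (4 : ℝ))).sub ((h1.mul h2).sqrt.const_mul 4)).add
      (hs.const_mul 5)
    norm_num at h3
    simpa using h3
  rw [Asymptotics.isLittleO_iff_tendsto']
  · refine hlim.congr' ?_
    filter_upwards [hpos] with p ⟨hp2, hp1⟩
    have hp2' : (0 : ℝ) < p.2 := by positivity
    have hprod : (0 : ℝ) < (p.1 : ℝ) * p.2 := mul_pos hp1 hp2'
    have hsp : 0 < √((p.1 : ℝ) * p.2) := Real.sqrt_pos.2 hprod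
    have hroot : √((p.1 : ℝ) * p.2) = p.1 * √(((p.1 : ℝ) / p.2)⁻¹) := by
      rw [Real.sqrt_eq_iff_mul_self_eq hprod.le (by positivity), mul_mul_mul_comm,
        Real.mul_self_sqrt (by positivity)]
      field_simp
    have hfac : ((2 * p.2 - 4 : ℕ) : ℝ) * (((p.1 : ℝ) - 1) / 2 - 2 * (4 * √((p.1 : ℝ) * p.2))) =
        (p.1 * p.2) * ((2 - 4 * (p.2 : ℝ)⁻¹) *
          ((1 - (p.1 : ℝ)⁻¹) / 2 - 8 * √(((p.1 : ℝ) / p.2)⁻¹))) := by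
      rw [Nat.cast_sub (by omega), hroot]
      push_cast
      field_simp
      ring
    rw [queryBound, hfac, Real.sqrt_mul hprod.le]
    field_simp
    ring
  · filter_upwards [hpos] with p ⟨hp2, hp1⟩ h
    have hp2' : (0 : ℝ) < p.2 := by positivity
    exact absurd h (Real.sqrt_pos.2 (mul_pos hp1 hp2')).ne'

end Asymptotics

end BlockSearch

theorem mainTheorem10 {α : Type*} [LinearOrder α] [Infinite α] :
    ∃ r : ℕ × ℕ → ℝ,
      r =o[BlockSearch.regime] (fun p : ℕ × ℕ => Real.sqrt ((p.1 : ℝ) * (p.2 : ℝ))) ∧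
      ∀ n k : ℕ, 1 ≤ n → ∀ S : BlockSearch.SearchAlg n, S.FindsTarget α k →
        ∃ (A : Fin n → α) (i : Fin n), BlockSearch.IsInstance k A i ∧
          4 * Real.sqrt ((n : ℝ) * (k : ℝ)) - r (n, k) ≤ (S.numQueries A (A i) : ℝ) := by
  refine ⟨_, BlockSearch.isLittleO_sub_queryBound, fun n k hn S hS => ?_⟩
  obtain ⟨A, i, hA, h⟩ := BlockSearch.exists_queryBound_le hn S hS
  exact ⟨A, i, hA, by simpa using h⟩
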